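/- All graphs are finite, simple and undirected. For a graph $G$ and a positive integer $k$, let $\alpha_k(G)$ be the maximum size of a union of $k$ independent sets of $G$. For a partition $\mathcal C$ of $V(G)$ into cliques let $m_k(\mathcal C)=\sum_{C\in\mathcal C}\min\{k,|C|\}$; $\mathcal C$ is called $k$-saturated if $\alpha_k(G)=m_k(\mathcal C)$. $G$ is a strong Greene–Kleitman (SGK) graph if, for each positive integer $k$, every induced subgraph of $G$ has a clique partition that is both $k$- and $(k+1)$-saturated. An SGK graph $G$ with clique number $c$ is polyunsaturated if no clique partition of $G$ is both $k$- and $l$-saturated for any distinct, nonconsecutive positive integers $k,l<c$. For $G$ with clique number $c$, let $\Delta\underline\alpha(G)$ be the sequence of length $c$ with terms $\Delta\alpha_1=\alpha_1(G)$ and $\Delta\alpha_i=\alpha_i(G)-\alpha_{i-1}(G)$ for $2\le i\le c$. A comparability graph is a graph whose vertices can be partially ordered so that two distinct vertices are adjacent if and only if they are comparable. Theorem. Let $c$ be a positive integer and let $\underline b=(b_1,b_2,\dotsc,b_c)$ be a nonincreasing sequence of positive integers. There exists a polyunsaturated SGK graph $G$ with clique number $c$ and $\Delta\underline\alpha(G)=\underline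 b$ if and only if $b_2>b_3>\dotsb>b_{c-1}$ (an empty condition if $c\le 3$). Moreover, the same equivalence holds if both $G$ and its complement $\overline G$ are required to be comparability graphs. -/

import Mathlib

universe u

namespace Polyunsaturated

open Finset

section Defs

variable {V : Type u} [Fintype V] [DecidableEq V]

/-- `alphaK G k` is the maximum size of a union of `k` independent sets of `G`. -/
noncomputable def alphaK (G : SimpleGraph V) (k : ℕ) : ℕ :=
  sSup {n | ∃ I : Fin k → Finset V, (∀ i, G.IsIndepSet (I i : Set V)) ∧
    (Finset.univ.biUnion I).card = n}

/-- The difference sequence of a sequence indexed from `1`: its `i`-th term is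
`a i - a (i - 1)`, with the convention that its first term is `a 1`. -/
def diffSeq (a : ℕ → ℕ) (i : ℕ) : ℤ :=
  if i = 1 then (a 1 : ℤ) else (a i : ℤ) - (a (i - 1) : ℤ)

/-- A partition of the vertex set (into nonempty parts) all of whose parts are cliques. -/
def IsCliquePartition (G : SimpleGraph V) (C : Finpartition (Finset.univ : Finset V)) : Prop :=
  ∀ p ∈ C.parts, G.IsClique (p : Set V)

/-- The `k`-norm of a partition: the sum of `min k |p|` over its parts `p`. -/
def kNorm (C : Finpartition (Finset.univ : Finset V)) (k : ℕ) : ℕ :=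
  ∑ p ∈ C.parts, min k p.card

/-- `C` is a `k`-saturated clique partition of `G`. -/
def IsSaturated (G : SimpleGraph V) (C : Finpartition (Finset.univ : Finset V)) (k : ℕ) : Prop :=
  IsCliquePartition G C ∧ alphaK G k = kNorm C k

/-- Strong Greene-Kleitman graphs: for each positive `k`, every induced subgraph has a clique
partition that is both `k`-saturated and `k + 1`-saturated. -/
def IsSGK (G : SimpleGraph V) : Prop :=
  ∀ S : Finset V, ∀ k : ℕ, 1 ≤ k →
    ∃ C : Finpartition (Finset.univ : Finset (S : Set V)),
      IsSaturated (G.induce (S : Set V)) C k ∧ IsSaturated (G.induce (S : Set V)) C (k + 1)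

/-- No clique partition is both `k`- and `l`-saturated, for any distinct, nonconsecutive positive
integers `k`, `l` less than the clique number. -/
def IsPolyunsaturated (G : SimpleGraph V) : Prop :=
  ∀ k l : ℕ, 1 ≤ k → 1 ≤ l → k < G.cliqueNum → l < G.cliqueNum →
    k ≠ l → k + 1 ≠ l → l + 1 ≠ k →
    ¬ ∃ C : Finpartition (Finset.univ : Finset V), IsSaturated G C k ∧ IsSaturated G C l

end Defs

/-- `G` is the comparability graph of some partial order on its vertex set. -/
def IsComparabilityGraph {V : Type u} (G : SimpleGraph V) : Prop :=
  ∃ P : PartialOrder V, ∀ x y : V, G.Adj x y ↔ (P.lt x y ∨ P.lt y x)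

end Polyunsaturated

set_option linter.unusedSectionVars false

namespace Polyunsaturated

open Finset

/-! ### Independent families and clique partitions -/

section General

variable {V : Type u} [Fintype V] [DecidableEq V]

/-! Necessity: `kNorm` is concave in k. If Δα_{k+2} ≥ Δα_{k+1}, a clique partition that is k- and
(k+1)-saturated is therefore also (k+2)-saturated, contrary to polyunsaturation when k + 2 < c
(`diffSeq_lt_of_isPolyunsaturated`).

Sufficiency: an explicit planar point set under dominance. Its graph and the complement are
comparability graphs, and comparability graphs are SGK by Greene–Kleitman (`exists_saturated`,
derived from assignment duality). The spine lies on a horizontal line. For 1 ≤ r ≤ c - 3, the r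
ordinary cells of row r lie beneath exactly the spine cells of columns ≥ r + 2; the exceptional cell
dominates exactly the spine cells of columns ≤ r + 1 and the ordinary cells of rows 1, ..., r - 1.
Level families and a chain cover give α_k = b_1 + ... + b_k.

Suppose a partition is k- and l-saturated with k + 2 ≤ l < c. An optimal k-family misses the
exceptional cell of row k, so its clique has more than k elements and must use the spine. An optimal
l-family misses that spine cell, so the clique has more than l elements; yet ranks bound it by k + 2
(`not_isSaturated_both`). -/

theorem card_biUnion_le_alphaK {G : SimpleGraph V} {k : ℕ} (I : Fin k → Finset V)
    (hI : ∀ i, G.IsIndepSet (I i : Set V)) : (univ.biUnion I).card ≤ alphaK G k := by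
  apply le_csSup
  · refine ⟨Fintype.card V, ?_⟩
    rintro n ⟨J, -, rfl⟩
    exact card_le_univ _
  · exact ⟨I, hI, rfl⟩

theorem alphaK_le {G : SimpleGraph V} {k N : ℕ}
    (h : ∀ I : Fin k → Finset V, (∀ i, G.IsIndepSet (I i : Set V)) →
      (univ.biUnion I).card ≤ N) : alphaK G k ≤ N := by
  apply csSup_le
  · exact ⟨_, fun _ => ∅, by simp, rfl⟩
  · rintro n ⟨I, hI, rfl⟩
    exact h I hI

theorem card_inter_biUnion_le {G : SimpleGraph V} {k : ℕ} (I : Fin k → Finset V)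
    (hI : ∀ i, G.IsIndepSet (I i : Set V)) {p : Finset V} (hp : G.IsClique (p : Set V)) :
    (p ∩ univ.biUnion I).card ≤ k := by
  rw [inter_biUnion]
  calc (univ.biUnion fun i => p ∩ I i).card ≤ ∑ i : Fin k, (p ∩ I i).card := card_biUnion_le
    _ ≤ ∑ _i : Fin k, 1 := by
        refine sum_le_sum fun i _ => card_le_one.2 fun a ha b hb => ?_
        rw [mem_inter] at ha hb
        by_contra hab
        exact hI i ha.2 hb.2 hab (hp ha.1 hb.1 hab)
    _ = k := by simp

theorem card_eq_sum_inter (C : Finpartition (univ : Finset V)) (U : Finset V) :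
    U.card = ∑ p ∈ C.parts, (p ∩ U).card := by
  rw [← card_biUnion]
  · congr 1
    ext x
    simp only [mem_biUnion, mem_inter]
    constructor
    · intro hx
      obtain ⟨p, hp, hxp⟩ := C.exists_mem (mem_univ x)
      exact ⟨p, hp, hxp, hx⟩
    · rintro ⟨p, -, -, hx⟩
      exact hx
  · intro p hp q hq hpq
    exact (C.disjoint hp hq hpq).mono inter_subset_left inter_subset_left

theorem card_inter_biUnion_le_min {G : SimpleGraph V} {k : ℕ} (I : Fin k → Finset V)
    (hI : ∀ i, G.IsIndepSet (I i : Set V)) {p : Finset V} (hp : G.IsClique (p : Set V)) :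
    (p ∩ univ.biUnion I).card ≤ min k p.card :=
  le_min (card_inter_biUnion_le I hI hp) (card_le_card inter_subset_left)

/-- Weak duality: a clique meets a union of k independent sets in at most k vertices. -/
theorem alphaK_le_kNorm {G : SimpleGraph V} {C : Finpartition (univ : Finset V)}
    (hC : IsCliquePartition G C) (k : ℕ) : alphaK G k ≤ kNorm C k := by
  refine alphaK_le fun I hI => ?_
  rw [card_eq_sum_inter C]
  exact sum_le_sum fun p hp => card_inter_biUnion_le_min I hI (hC p hp)

/-- A part of a `k`-saturated partition that is not covered by some maximum `k`-family has more
than `k` elements. -/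
theorem lt_card_of_notMem_biUnion {G : SimpleGraph V} {C : Finpartition (univ : Finset V)} {k : ℕ}
    (hC : IsSaturated G C k) (I : Fin k → Finset V) (hI : ∀ i, G.IsIndepSet (I i : Set V))
    (hmax : alphaK G k ≤ (univ.biUnion I).card) {p : Finset V} (hp : p ∈ C.parts) {x : V}
    (hx : x ∈ p) (hxI : x ∉ univ.biUnion I) : k < p.card := by
  by_contra! hle
  have hlt : (p ∩ univ.biUnion I).card < min k p.card := by
    rw [min_eq_right hle]
    refine card_lt_card ⟨inter_subset_left, fun h => hxI ?_⟩
    exact (mem_inter.1 (h hx)).2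
  have : (univ.biUnion I).card < kNorm C k := by
    rw [card_eq_sum_inter C]
    exact sum_lt_sum (fun q hq => card_inter_biUnion_le_min I hI (hC.1 q hq)) ⟨p, hp, hlt⟩
  have := hC.2
  omega

/-- An upper bound for `alphaK` from a family of cliques covering all vertices outside `R`. -/
theorem alphaK_le_of_cover {ι : Type*} [DecidableEq ι] {G : SimpleGraph V} (k : ℕ) (R : Finset V)
    (D : Finset ι) (φ : V → ι) (hφ : ∀ x, x ∉ R → φ x ∈ D)
    (hadj : ∀ x y, x ∉ R → y ∉ R → φ x = φ y → x ≠ y → G.Adj x y) :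
    alphaK G k ≤ R.card + k * D.card := by
  refine alphaK_le fun I hI => ?_
  set U := univ.biUnion I with hU
  have h1 : (U \ R).card ≤ k * D.card := by
    refine card_le_mul_card_image_of_maps_to (f := φ) ?_ k ?_
    · intro x hx
      exact hφ x (mem_sdiff.1 hx).2
    · intro t _
      have hcl : G.IsClique ((((U \ R).filter fun x => φ x = t) : Finset V) : Set V) := by
        intro x hx y hy hxy
        simp only [coe_filter, mem_sdiff, Set.mem_ofPred_eq] at hx hy
        exact hadj x y hx.1.2 hy.1.2 (hx.2.trans hy.2.symm) hxy
      refine le_trans (card_le_card ?_) (card_inter_biUnion_le I hI hcl)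
      intro x hx
      exact mem_inter.2 ⟨hx, (mem_sdiff.1 (mem_filter.1 hx).1).1⟩
  have h2 : U.card ≤ (U \ R).card + R.card := by
    exact card_le_card_sdiff_add_card
  omega

theorem kNorm_concave (C : Finpartition (univ : Finset V)) (k : ℕ) :
    kNorm C (k + 2) + kNorm C k ≤ 2 * kNorm C (k + 1) := by
  unfold kNorm
  rw [← sum_add_distrib, mul_sum]
  exact sum_le_sum fun p _ => by omega

end General

/-! ### Transport along isomorphisms -/

section Iso

variable {V W : Type*} [Fintype V] [DecidableEq V] [Fintype W] [DecidableEq W]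

theorem alphaK_le_of_iso {G : SimpleGraph V} {H : SimpleGraph W} (e : G ≃g H) (k : ℕ) :
    alphaK G k ≤ alphaK H k := by
  refine alphaK_le fun I hI => ?_
  have h := card_biUnion_le_alphaK (G := H) (fun i => (I i).map e.toEquiv.toEmbedding) (by
    intro i x hx y hy hxy
    simp only [coe_map, Set.mem_image] at hx hy
    obtain ⟨x, hx, rfl⟩ := hx
    obtain ⟨y, hy, rfl⟩ := hy
    intro h
    exact hI i hx hy (fun h' => hxy (by rw [h'])) (e.map_adj_iff.1 h))
  refine le_trans (le_of_eq ?_) h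
  have : (univ.biUnion fun i => (I i).map e.toEquiv.toEmbedding) =
      (univ.biUnion I).map e.toEquiv.toEmbedding := by
    ext x
    simp only [mem_biUnion, mem_map, mem_univ, true_and]
    constructor
    · rintro ⟨i, y, hy, rfl⟩
      exact ⟨y, ⟨i, hy⟩, rfl⟩
    · rintro ⟨y, ⟨i, hy⟩, rfl⟩
      exact ⟨i, y, hy, rfl⟩
  rw [this, card_map]

theorem alphaK_eq_of_iso {G : SimpleGraph V} {H : SimpleGraph W} (e : G ≃g H) (k : ℕ) :
    alphaK G k = alphaK H k :=
  le_antisymm (alphaK_le_of_iso e k) (alphaK_le_of_iso e.symm k)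

theorem exists_saturated_of_iso {G : SimpleGraph V} {H : SimpleGraph W} (e : G ≃g H)
    (C : Finpartition (univ : Finset V)) :
    ∃ C' : Finpartition (univ : Finset W), ∀ k, IsSaturated G C k → IsSaturated H C' k := by
  let E := e.toEquiv.toEmbedding
  let C' : Finpartition (univ : Finset W) :=
    { parts := C.parts.map ⟨fun p => p.map E, map_injective E⟩
      supIndep := by
        rw [supIndep_iff_pairwiseDisjoint]
        intro p hp q hq hpq
        simp only [coe_map, Set.mem_image, Function.Embedding.coeFn_mk] at hp hq
        obtain ⟨p, hp, rfl⟩ := hp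
        obtain ⟨q, hq, rfl⟩ := hq
        exact (disjoint_map E).2 (C.disjoint hp hq fun h => hpq (by rw [h]))
      sup_parts := by
        ext x
        simp only [mem_sup, mem_map, Function.Embedding.coeFn_mk, id, mem_univ, iff_true]
        obtain ⟨p, hp, hxp⟩ := C.exists_mem (mem_univ (e.symm x))
        exact ⟨_, ⟨p, hp, rfl⟩, mem_map.2 ⟨_, hxp, e.apply_symm_apply x⟩⟩
      bot_notMem := by
        simp only [bot_eq_empty, mem_map, Function.Embedding.coeFn_mk, map_eq_empty]
        rintro ⟨p, hp, rfl⟩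
        exact C.bot_notMem hp }
  refine ⟨C', fun k hk => ⟨?_, ?_⟩⟩
  · intro p hp
    obtain ⟨p, hpC, rfl⟩ := mem_map.1 hp
    intro x hx y hy hxy
    simp only [Function.Embedding.coeFn_mk, coe_map, Set.mem_image] at hx hy
    obtain ⟨x, hx, rfl⟩ := hx
    obtain ⟨y, hy, rfl⟩ := hy
    exact e.map_adj_iff.2 (hk.1 p hpC hx hy fun h => hxy (by rw [h]))
  · rw [← alphaK_eq_of_iso e, hk.2]
    simp [kNorm, C', sum_map]

end Iso

/-! ### The assignment problem -/

/-- Strong duality for the assignment problem with integer costs. -/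
theorem exists_perm_dual {W : Type*} [Fintype W] [DecidableEq W] (c : W → W → ℤ) :
    ∃ (σ : Equiv.Perm W) (y z : W → ℤ), (∀ v w, y v - z w ≤ c v w) ∧
      ∀ v, y v - z (σ v) = c v (σ v) := by
  classical
  obtain ⟨M, ⟨y, z, hyz, hM⟩, hmax⟩ := Int.exists_greatest_of_bdd
    (P := fun n => ∃ y z : W → ℤ, (∀ v w, y v - z w ≤ c v w) ∧ ∑ v, y v - ∑ v, z v = n)
    ⟨∑ v, c v v, by
      rintro n ⟨y, z, h, rfl⟩
      rw [← sum_sub_distrib]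
      exact sum_le_sum fun v _ => h v v⟩
    ⟨_, fun v => -∑ w, |c v w|, fun _ => 0, fun v w => by
      have := single_le_sum (f := fun w => |c v w|) (fun i _ => abs_nonneg _) (mem_univ w)
      have := neg_abs_le (c v w)
      simp only at *
      linarith, rfl⟩
  -- Hall's condition for the tight pairs of an optimal dual: if A violated it, raising y on A and z
  -- on the tight neighbours of A by 1 would stay feasible, by integrality, and increase the
  -- objective.
  have hall : ∀ A : Finset W,
      A.card ≤ (A.biUnion fun v => univ.filter fun w => y v - z w = c v w).card := by
    intro A
    set N := A.biUnion fun v => univ.filter fun w => y v - z w = c v w with hN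
    have := hmax (∑ v, (y v + if v ∈ A then 1 else 0) - ∑ v, (z v + if v ∈ N then 1 else 0))
      ⟨_, _, fun v w => ?_, rfl⟩
    · simp only [sum_add_distrib, sum_ite_mem, univ_inter, sum_const, mul_one, nsmul_eq_mul] at this
      have : (A.card : ℤ) ≤ N.card := by linarith
      exact_mod_cast this
    · have h := hyz v w
      by_cases hv : v ∈ A
      · by_cases hw : w ∈ N
        · simp only [hv, hw, if_true]
          linarith
        · have : y v - z w ≠ c v w := fun h' =>
            hw (mem_biUnion.2 ⟨v, hv, by simpa using h'⟩)
          simp only [hv, hw, if_true, if_false]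
          omega
      · by_cases hw : w ∈ N <;> simp only [hv, hw, if_true, if_false] <;> linarith
  obtain ⟨f, hf, hft⟩ := (all_card_le_biUnion_card_iff_exists_injective _).1 hall
  refine ⟨Equiv.ofBijective f (Finite.injective_iff_bijective.1 hf), y, z, hyz, fun v => ?_⟩
  simpa using hft v

/-! ### The Greene-Kleitman theorem -/

section GreeneKleitman

variable {W : Type*} [Fintype W] [DecidableEq W] [PartialOrder W]

/-- The descending steps `σ b < b` of a permutation `σ` of a finite poset link the elements into
disjoint chains; these partition the poset. -/
theorem exists_chain_partition (G : SimpleGraph W) (hG : ∀ x y, G.Adj x y ↔ x < y ∨ y < x)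
    (σ : Equiv.Perm W) :
    ∃ C : Finpartition (univ : Finset W), IsCliquePartition G C ∧
      ∀ p ∈ C.parts, ∃ r ∈ p, ¬ σ r < r ∧ (σ r = r → p = {r}) := by
  classical
  let R : W → W → Prop := fun a b => σ b = a ∧ a < b
  -- Injectivity of σ makes the upward step from an element unique, so elements with a common root
  -- are comparable.
  have hR : Relator.RightUnique R := fun a b b' h h' => σ.injective (h.1.trans h'.1.symm)
  have hle : ∀ {a b}, Relation.ReflTransGen R a b → a ≤ b := by
    intro a b h
    induction h with
    | refl => exact le_rfl
    | tail _ h ih => exact ih.trans h.2.le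
  have hroot : ∀ x : W, ∃ r, Relation.ReflTransGen R r x ∧ ¬ σ r < r := by
    intro x
    induction x using WellFoundedLT.induction with
    | ind x ih =>
      by_cases hx : σ x < x
      · obtain ⟨r, hr, hr'⟩ := ih _ hx
        exact ⟨r, hr.tail ⟨rfl, hx⟩, hr'⟩
      · exact ⟨x, .refl, hx⟩
  choose ρ hρ hρ' using hroot
  have hρρ : ∀ x, ρ (ρ x) = ρ x := by
    intro x
    rcases Relation.ReflTransGen.cases_tail (hρ (ρ x)) with h | ⟨b, -, hb, hb'⟩
    · exact h.symm
    · exact absurd (hb.symm ▸ hb') (hρ' x)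
  let C := Finpartition.ofSetoid (Setoid.ker ρ)
  have hmem : ∀ p ∈ C.parts, ∀ x ∈ p, ∀ y, y ∈ p ↔ ρ x = ρ y := by
    intro p hp x hx y
    have hpx : C.part x = p := C.part_eq_of_mem hp hx
    rw [← hpx]
    exact Finpartition.mem_part_ofSetoid_iff_rel
  refine ⟨C, ?_, ?_⟩
  · intro p hp x hx y hy hxy
    have h : ρ x = ρ y := (hmem p hp x hx y).1 hy
    rw [hG]
    rcases Relation.ReflTransGen.total_of_right_unique hR (hρ x) (h ▸ hρ y) with h | h
    · exact Or.inl (lt_of_le_of_ne (hle h) hxy)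
    · exact Or.inr (lt_of_le_of_ne (hle h) (Ne.symm hxy))
  · intro p hp
    obtain ⟨x, hx⟩ := C.nonempty_of_mem_parts hp
    have hr : ρ x ∈ p := (hmem p hp x hx _).2 (hρρ x).symm
    refine ⟨ρ x, hr, hρ' x, fun hfix => ?_⟩
    rw [eq_singleton_iff_unique_mem]
    refine ⟨hr, fun y hy => ?_⟩
    have h : ρ x = ρ y := (hmem p hp x hx y).1 hy
    rcases Relation.ReflTransGen.cases_head (h ▸ hρ y) with h' | ⟨b, ⟨hb, hb'⟩, -⟩
    · exact h'.symm
    · exact absurd (σ.injective (hfix.trans hb.symm)) hb'.ne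

/-- In a finite poset, some chain partition is both `k`- and `(k + 1)`-saturated. -/
theorem exists_saturated (G : SimpleGraph W) (hG : ∀ x y, G.Adj x y ↔ x < y ∨ y < x) (k : ℕ)
    (hk : 1 ≤ k) : ∃ C : Finpartition (univ : Finset W),
      IsSaturated G C k ∧ IsSaturated G C (k + 1) := by
  classical
  -- Descending steps are free. The root of a chain pays at least the chain's contribution to the
  -- two norms: 2 for a fixed point, which is a singleton chain, and otherwise 2k + 1 = k + (k + 1).
  let c : W → W → ℤ := fun v w => if w < v then 0 else if w = v then 2 else 2 * k + 1
  have hc0 : ∀ v w, 0 ≤ c v w := by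
    intro v w
    simp only [c]
    split_ifs <;> omega
  obtain ⟨σ, y, z, hyz, htight⟩ := exists_perm_dual c
  obtain ⟨C, hC, hCr⟩ := exists_chain_partition G hG σ
  have hupper : ((kNorm C k + kNorm C (k + 1) : ℕ) : ℤ) ≤ ∑ v, (y v - z v) := by
    have hsum : ∑ v, (y v - z v) = ∑ v, c v (σ v) := by
      rw [sum_sub_distrib, ← Equiv.sum_comp σ z, ← sum_sub_distrib]
      exact sum_congr rfl fun v _ => htight v
    have hparts : ∑ v, c v (σ v) = ∑ p ∈ C.parts, ∑ v ∈ p, c v (σ v) := by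
      have h := sum_biUnion (f := fun v => c v (σ v)) C.disjoint
      rw [C.biUnion_parts] at h
      exact h
    rw [hsum, hparts, kNorm, kNorm, ← sum_add_distrib]
    push_cast
    refine sum_le_sum fun p hp => ?_
    obtain ⟨r, hr, hlt, hfix⟩ := hCr p hp
    refine le_trans ?_ (single_le_sum (f := fun v => c v (σ v)) (fun v _ => hc0 _ _) hr)
    simp only [c, if_neg hlt]
    split_ifs with h
    · rw [hfix h]
      simp only [card_singleton]
      omega
    · omega
  have hlower : ∑ v, (y v - z v) ≤ ((alphaK G k + alphaK G (k + 1) : ℕ) : ℤ) := by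
    rcases isEmpty_or_nonempty W with hW | hW
    · simp
      positivity
    obtain ⟨v₀, hv₀⟩ := Finite.exists_min z
    -- Read v as the interval [z v, y v), shifted so that the least z is 0. Zero cost on descending
    -- pairs makes the intervals of comparable elements disjoint.
    have hA : ∀ t : ℤ, G.IsIndepSet
        ((univ.filter fun v => z v - z v₀ ≤ t ∧ t < y v - z v₀ : Finset W) : Set W) := by
      intro t a ha b hb hab hadj
      simp only [coe_filter, mem_univ, true_and, Set.mem_ofPred_eq] at ha hb
      rcases (hG a b).1 hadj with h | h
      · have := hyz b a
        simp only [c, if_pos h] at this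
        omega
      · have := hyz a b
        simp only [c, if_pos h] at this
        omega
    -- The intervals lie in [0, 2k + 1), which has k odd and k + 1 even levels. Each has length at
    -- most 2, so its length is at most the number of the two unions containing v.
    have h1 := card_biUnion_le_alphaK (G := G) (fun i : Fin k => univ.filter fun v =>
      z v - z v₀ ≤ 2 * (i : ℕ) + 1 ∧ 2 * ((i : ℕ) : ℤ) + 1 < y v - z v₀) (fun i => hA _)
    have h2 := card_biUnion_le_alphaK (G := G) (fun i : Fin (k + 1) => univ.filter fun v =>
      z v - z v₀ ≤ 2 * (i : ℕ) ∧ 2 * ((i : ℕ) : ℤ) < y v - z v₀) (fun i => hA _)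
    refine le_trans ?_ (Int.ofNat_le.2 (add_le_add h1 h2))
    have hind : ∀ A : Finset W, (A.card : ℤ) = ∑ v, if v ∈ A then 1 else 0 := by simp
    rw [Nat.cast_add, hind, hind, ← sum_add_distrib]
    refine sum_le_sum fun v _ => ?_
    have hz := hv₀ v
    have hy : y v - z v₀ ≤ 2 * k + 1 := by
      refine (hyz v v₀).trans ?_
      simp only [c]
      split_ifs <;> omega
    have hvv : y v - z v ≤ 2 := by simpa [c] using hyz v v
    have hodd : ∀ t : ℕ, (¬ ∃ i : Fin k,
        z v - z v₀ ≤ 2 * (i : ℕ) + 1 ∧ 2 * ((i : ℕ) : ℤ) + 1 < y v - z v₀) →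
        ¬ (z v - z v₀ ≤ 2 * t + 1 ∧ 2 * (t : ℤ) + 1 < y v - z v₀) :=
      fun t h ht => h ⟨⟨t, by omega⟩, ht⟩
    have heven : ∀ t : ℕ, (¬ ∃ i : Fin (k + 1),
        z v - z v₀ ≤ 2 * (i : ℕ) ∧ 2 * ((i : ℕ) : ℤ) < y v - z v₀) →
        ¬ (z v - z v₀ ≤ 2 * t ∧ 2 * (t : ℤ) < y v - z v₀) :=
      fun t h ht => h ⟨⟨t, by omega⟩, ht⟩
    simp only [mem_biUnion, mem_filter, mem_univ, true_and]
    have ho := hodd ((z v - z v₀) / 2).toNat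
    have he := heven ((z v - z v₀ + 1) / 2).toNat
    split_ifs with h1 h2 h2
    · omega
    · have := he h2
      omega
    · have := ho h1
      omega
    · have := he h2
      have := ho h1
      omega
  have h1 := alphaK_le_kNorm hC k
  have h2 := alphaK_le_kNorm hC (k + 1)
  have h3 := Int.ofNat_le.1 (hupper.trans hlower)
  exact ⟨C, ⟨hC, by omega⟩, ⟨hC, by omega⟩⟩

theorem isSGK_of_isComparabilityGraph {V : Type u} [Fintype V] [DecidableEq V]
    {G : SimpleGraph V} (h : IsComparabilityGraph G) : IsSGK G := by
  obtain ⟨P, hP⟩ := h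
  intro S k hk
  exact exists_saturated (G.induce (S : Set V)) (fun x y => hP x y) k hk

end GreeneKleitman

/-! ### The extremal graphs

The vertices are the cells `(row, col)` of an array with `c` columns. Row `0` is a clique of size `c`
(the spine). For `1 ≤ r ≤ c - 3`, row `r` consists of `r + 1` cells, the last of which is called
exceptional. The rows below contain the remaining cells: they are cliques without neighbours in
other rows. Column `a` has `b a` cells. -/

section Cells

/-- The first nonzero row of column `a`. -/
def firstRow (c a : ℕ) : ℕ := min (max 1 (a - 1)) (c - 3 + 1)

/-- The first row below all cells of column `a`. -/
def endRow (c : ℕ) (b : ℕ → ℕ) (a : ℕ) : ℕ := firstRow c a + b a - 1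

/-- The rows of the cells of column `a`. -/
def column (c : ℕ) (b : ℕ → ℕ) (a : ℕ) : Finset ℕ := insert 0 (Ico (firstRow c a) (endRow c b a))

/-- The cells of the first `k` columns. -/
def cells (c : ℕ) (b : ℕ → ℕ) (k : ℕ) : Finset (Σ _ : ℕ, ℕ) := (Icc 1 k).sigma (column c b)

/-- The horizontal coordinate of a cell in the plane. -/
def position (c r a : ℕ) : ℕ :=
  if r = 0 then 3 * a
  else if r ≤ c - 3 then (if a = r + 1 then 3 * (r + 1) + 1 else 3 * (r + 1) + 2)
  else 3 * (r + c)

/-- The vertical coordinate of a cell in the plane. -/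
def height (c r a : ℕ) : ℤ := if 1 ≤ r ∧ r ≤ c - 3 ∧ a = r + 1 then (c : ℤ) - r else -r

/-- A rank function with values in `{1, ..., c}`, increasing for the dominance order. -/
def rank (c r a : ℕ) : ℕ := if 1 ≤ r ∧ r ≤ c - 3 ∧ a = r + 1 then r + 2 else a

/-- A partition of the cells into `c` antichains; the spine cell of column `t + 1` has
the largest level `c`. -/
def level (c t r a : ℕ) : ℕ :=
  if r = 0 then (if a ≤ t then a else if a = t + 1 then c else a - 1)
  else if r ≤ c - 3 ∧ a = r + 1 then max t r + 1 else a

/-- A labelling used to cover most cells by chains. -/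
def chainLabel (c k r a : ℕ) : ℕ :=
  if r = 0 then (if k ≤ min (a - 2) (c - 3) then min (a - 2) (c - 3) else 0)
  else if r ≤ c - 3 ∧ a = r + 1 then (if k ≤ r - 1 then r - 1 else 0) else r

variable (c : ℕ) (b : ℕ → ℕ)

/-- The vertex type of the extremal graph. -/
abbrev Cell : Type u := ULift.{u} {x : Σ _ : ℕ, ℕ // x ∈ cells c b c}

variable {c b}

/-- The row of a cell. -/
def Cell.row (x : Cell.{u} c b) : ℕ := x.down.1.2

/-- The column of a cell. -/
def Cell.col (x : Cell.{u} c b) : ℕ := x.down.1.1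

theorem Cell.ext_row_col {x y : Cell.{u} c b} (h : x.row = y.row) (h' : x.col = y.col) : x = y := by
  obtain ⟨⟨⟨a, r⟩, hx⟩⟩ := x
  obtain ⟨⟨⟨a', r'⟩, hy⟩⟩ := y
  simp only [row, col] at h h'
  subst h h'
  rfl

theorem mem_column {a r : ℕ} :
    r ∈ column c b a ↔ r = 0 ∨ (firstRow c a ≤ r ∧ r < endRow c b a) := by
  simp [column]

theorem Cell.row_mem_column (x : Cell.{u} c b) : x.row ∈ column c b x.col :=
  (mem_sigma.1 x.down.2).2

theorem Cell.one_le_col (x : Cell.{u} c b) : 1 ≤ x.col :=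
  (mem_Icc.1 (mem_sigma.1 x.down.2).1).1

theorem Cell.col_le (x : Cell.{u} c b) : x.col ≤ c :=
  (mem_Icc.1 (mem_sigma.1 x.down.2).1).2

theorem Cell.spec (x : Cell.{u} c b) : 1 ≤ x.col ∧ x.col ≤ c ∧
    (x.row = 0 ∨ (1 ≤ x.row ∧ x.row ≤ c - 3 ∧ x.col ≤ x.row + 1) ∨ c - 3 < x.row) := by
  have h := mem_column.1 x.row_mem_column
  have := x.one_le_col
  have := x.col_le
  unfold firstRow at h
  omega

theorem exists_cell {a r : ℕ} (h1 : 1 ≤ a) (hc : a ≤ c) (h : r ∈ column c b a) :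
    ∃ x : Cell.{u} c b, x.row = r ∧ x.col = a :=
  ⟨⟨⟨⟨a, r⟩, mem_sigma.2 ⟨mem_Icc.2 ⟨h1, hc⟩, h⟩⟩⟩, rfl, rfl⟩

theorem card_column {a : ℕ} (h : 1 ≤ b a) : (column c b a).card = b a := by
  rw [column, card_insert_of_notMem, Nat.card_Ico]
  · unfold endRow
    omega
  · simp [firstRow]

theorem card_col_le {k : ℕ} (hk : k ≤ c) (hpos : ∀ i, 1 ≤ i → i ≤ c → 1 ≤ b i) :
    ((univ : Finset (Cell.{u} c b)).filter fun x => x.col ≤ k).card = ∑ i ∈ Icc 1 k, b i := by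
  have h : (cells c b k).card = ∑ i ∈ Icc 1 k, b i := by
    rw [cells, card_sigma]
    refine sum_congr rfl fun i hi => ?_
    rw [mem_Icc] at hi
    exact card_column (hpos i hi.1 (hi.2.trans hk))
  rw [← h]
  refine card_bij (fun x _ => x.down.1) ?_ ?_ ?_
  · intro x hx
    rw [mem_filter] at hx
    exact mem_sigma.2 ⟨mem_Icc.2 ⟨x.one_le_col, hx.2⟩, x.row_mem_column⟩
  · intro x _ y _ hxy
    exact ULift.ext _ _ (Subtype.ext hxy)
  · intro z hz
    obtain ⟨hz1, hz2⟩ := mem_sigma.1 hz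
    rw [mem_Icc] at hz1
    exact ⟨⟨⟨z, mem_sigma.2 ⟨mem_Icc.2 ⟨hz1.1, hz1.2.trans hk⟩, hz2⟩⟩⟩,
      mem_filter.2 ⟨mem_univ _, hz1.2⟩, rfl⟩

/-- `x` lies to the left of `y`. -/
def Cell.Left (x y : Cell.{u} c b) : Prop :=
  position c x.row x.col < position c y.row y.col ∨
    position c x.row x.col = position c y.row y.col ∧ x.col < y.col

/-- `x` lies lower than `y`. -/
def Cell.Lower (x y : Cell.{u} c b) : Prop :=
  height c x.row x.col < height c y.row y.col ∨
    height c x.row x.col = height c y.row y.col ∧ x.col < y.col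

/-- The strict dominance order. -/
def Cell.Below (x y : Cell.{u} c b) : Prop := x.Left y ∧ x.Lower y

theorem Cell.left_or_left {x y : Cell.{u} c b} (h : x ≠ y) : x.Left y ∨ y.Left x := by
  have hx := x.spec
  have hy := y.spec
  have h' : x.row = y.row → x.col ≠ y.col := fun h1 h2 => h (ext_row_col h1 h2)
  unfold Left position
  split_ifs <;> omega

theorem Cell.lower_or_lower {x y : Cell.{u} c b} (h : x ≠ y) : x.Lower y ∨ y.Lower x := by
  have hx := x.spec
  have hy := y.spec
  have h' : x.row = y.row → x.col ≠ y.col := fun h1 h2 => h (ext_row_col h1 h2)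
  unfold Lower height
  split_ifs <;> omega

variable (c b) in
/-- The comparability graph of the dominance order. -/
def cellGraph : SimpleGraph (Cell.{u} c b) where
  Adj x y := x.Below y ∨ y.Below x
  symm := ⟨fun _ _ h => h.symm⟩
  loopless := ⟨fun x h => by
    simp only [Cell.Below, Cell.Left] at h
    omega⟩

theorem cellGraph_adj {x y : Cell.{u} c b} :
    (cellGraph c b).Adj x y ↔ x.Below y ∨ y.Below x := Iff.rfl

theorem isComparabilityGraph_of_rel {V : Type u} {G : SimpleGraph V} (R : V → V → Prop)
    (hirr : ∀ x, ¬ R x x) (htrans : ∀ x y z, R x y → R y z → R x z)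
    (hG : ∀ x y, G.Adj x y ↔ R x y ∨ R y x) : IsComparabilityGraph G := by
  classical
  have : IsStrictOrder V R := { irrefl := hirr, trans := htrans }
  exact ⟨partialOrderOfSO R, hG⟩

theorem isComparabilityGraph_cellGraph : IsComparabilityGraph (cellGraph.{u} c b) := by
  refine isComparabilityGraph_of_rel Cell.Below ?_ ?_ fun _ _ => Iff.rfl
  · intro x h
    simp only [Cell.Below, Cell.Left] at h
    omega
  · intro x y z h h'
    simp only [Cell.Below, Cell.Left, Cell.Lower] at *
    omega

/-- Left and lower are linear orders; two points incomparable for dominance are comparable once the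
vertical order is reversed. -/
theorem isComparabilityGraph_compl_cellGraph : IsComparabilityGraph (cellGraph.{u} c b)ᶜ := by
  refine isComparabilityGraph_of_rel (fun x y => x.Left y ∧ y.Lower x) ?_ ?_ fun x y => ?_
  · intro x h
    simp only [Cell.Left] at h
    omega
  · intro x y z h h'
    simp only [Cell.Left, Cell.Lower] at *
    omega
  · rw [SimpleGraph.compl_adj]
    by_cases hxy : x = y
    · subst hxy
      simp [Cell.Left, Cell.Lower]
    · have h1 := Cell.left_or_left hxy
      have h2 := Cell.lower_or_lower hxy
      rw [and_iff_right hxy, cellGraph_adj]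
      simp only [Cell.Below, Cell.Left, Cell.Lower] at *
      omega

theorem rank_lt_rank {x y : Cell.{u} c b} (h : x.Below y) :
    rank c x.row x.col < rank c y.row y.col := by
  have hx := x.spec
  have hy := y.spec
  simp only [Cell.Below, Cell.Left, Cell.Lower] at h
  unfold position height at h
  unfold rank
  split_ifs at h ⊢ <;> omega

theorem level_ne_level {t : ℕ} (ht : t + 1 ≤ c) {x y : Cell.{u} c b} (h : x.Below y) :
    level c t x.row x.col ≠ level c t y.row y.col := by
  have hx := x.spec
  have hy := y.spec
  simp only [Cell.Below, Cell.Left, Cell.Lower] at h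
  unfold position height at h
  unfold level
  split_ifs at h ⊢ <;> omega

end Cells

/-! ### Parameters of the extremal graphs -/

section Extremal

variable {c : ℕ} {b : ℕ → ℕ}

/-- This is where strict decrease enters: `firstRow` rises by one at each step from column 2 to
column c - 1, and the strict drop of b compensates. At the other steps it is constant. For c ≤ 3
truncation makes it constantly 1. -/
theorem endRow_antitone (hpos : ∀ i, 1 ≤ i → i ≤ c → 1 ≤ b i)
    (hmono : ∀ i, 1 ≤ i → i + 1 ≤ c → b (i + 1) ≤ b i)
    (hb : ∀ i, 2 ≤ i → i + 1 ≤ c - 1 → b (i + 1) < b i) {i j : ℕ} (hi : 1 ≤ i) (hij : i ≤ j)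
    (hj : j ≤ c) : endRow c b j ≤ endRow c b i := by
  induction j, hij using Nat.le_induction with
  | base => exact le_rfl
  | succ j hij ih =>
    refine le_trans ?_ (ih (by omega))
    have h1 := hmono j (by omega) hj
    have h2 := hb j
    have h3 := hpos (j + 1) (by omega) hj
    unfold endRow firstRow
    omega

theorem le_endRow (hpos : ∀ i, 1 ≤ i → i ≤ c → 1 ≤ b i)
    (hmono : ∀ i, 1 ≤ i → i + 1 ≤ c → b (i + 1) ≤ b i)
    (hb : ∀ i, 2 ≤ i → i + 1 ≤ c - 1 → b (i + 1) < b i) {i : ℕ} (hi : 1 ≤ i) (hic : i ≤ c) :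
    c - 3 + 1 ≤ endRow c b i := by
  refine le_trans ?_ (endRow_antitone hpos hmono hb hi hic le_rfl)
  have := hpos c (by omega) le_rfl
  unfold endRow firstRow
  omega

/-- The cells of level `i + 1`. -/
def levelSet (c : ℕ) (b : ℕ → ℕ) (t i : ℕ) : Finset (Cell.{u} c b) :=
  univ.filter fun x => level c t x.row x.col = i + 1

theorem isIndepSet_levelSet {t : ℕ} (ht : t + 1 ≤ c) (i : ℕ) :
    (cellGraph.{u} c b).IsIndepSet (levelSet c b t i : Set (Cell.{u} c b)) := by
  intro x hx y hy _ h
  simp only [levelSet, coe_filter, mem_univ, true_and, Set.mem_ofPred_eq] at hx hy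
  rcases h with h | h
  · exact level_ne_level ht h (hx.trans hy.symm)
  · exact level_ne_level ht h (hy.trans hx.symm)

theorem one_le_level {t : ℕ} (x : Cell.{u} c b) : 1 ≤ level c t x.row x.col := by
  have := x.spec
  unfold level
  split_ifs <;> omega

theorem mem_biUnion_levelSet {t k : ℕ} {x : Cell.{u} c b} :
    x ∈ univ.biUnion (fun i : Fin k => levelSet c b t i) ↔ level c t x.row x.col ≤ k := by
  have := one_le_level (t := t) x
  simp only [mem_biUnion, levelSet, mem_filter, mem_univ, true_and]
  constructor
  · rintro ⟨i, hi⟩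
    omega
  · intro h
    exact ⟨⟨level c t x.row x.col - 1, by omega⟩, by simp only; omega⟩

/-- Nonspine cells of the first k columns have level at most k, since t + 1 ≤ k; spine cells are
matched with the spine cells whose levels are 1, ..., k. -/
theorem card_col_le_card_level {t k : ℕ} (htk : t + 1 ≤ k) (hk : k ≤ c) :
    ((univ : Finset (Cell.{u} c b)).filter fun x => x.col ≤ k).card ≤
      (univ.biUnion fun i : Fin k => levelSet.{u} c b t i).card := by
  refine card_le_card_of_forall_subsingleton
    (fun x y => x.row = y.row ∧ (x.row ≠ 0 → x.col = y.col) ∧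
      (x.row = 0 → level c t y.row y.col = x.col)) ?_ ?_
  · intro x hx
    rw [mem_filter] at hx
    have hs := x.spec
    by_cases h0 : x.row = 0
    · obtain ⟨y, hy, hy'⟩ := exists_cell.{u} (c := c) (b := b) (r := 0)
        -- Inverts the level on the spine: column t + 1 has level c, and the columns after it are
        -- shifted down by one.
        (a := if x.col ≤ t then x.col else if x.col = c then t + 1 else x.col + 1)
        (by split_ifs <;> omega) (by split_ifs <;> omega) (mem_column.2 (Or.inl rfl))
      have hl : level c t y.row y.col = x.col := by
        rw [hy, hy', level, if_pos rfl]
        split_ifs <;> omega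
      exact ⟨y, mem_biUnion_levelSet.2 (hl ▸ hx.2), by omega, fun h => absurd h0 h, fun _ => hl⟩
    · refine ⟨x, mem_biUnion_levelSet.2 ?_, rfl, fun _ => rfl, fun h => absurd h h0⟩
      unfold level
      split_ifs <;> omega
  · rintro y - x ⟨-, h1, h2, h3⟩ x' ⟨-, h1', h2', h3'⟩
    refine Cell.ext_row_col (h1.trans h1'.symm) ?_
    by_cases h0 : x.row = 0
    · rw [← h3 h0, ← h3' (by omega)]
    · rw [h2 h0, h2' (by omega)]

/-- The rows containing the cells of column `k`, except an exceptional one. -/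
def longRows (c : ℕ) (b : ℕ → ℕ) (k : ℕ) : Finset ℕ :=
  (column c b k).filter fun r => ¬ (1 ≤ r ∧ r ≤ c - 3 ∧ k = r + 1)

theorem mem_longRows {k r : ℕ} (hk : 1 ≤ k) (hkc : k ≤ c)
    (hend : ∀ i, 1 ≤ i → i ≤ c → c - 3 + 1 ≤ endRow c b i) :
    r ∈ longRows c b k ↔
      r = 0 ∨ (1 ≤ r ∧ r ≤ c - 3 ∧ k ≤ r) ∨ (c - 3 < r ∧ r < endRow c b k) := by
  have := hend k hk hkc
  rw [longRows, mem_filter, mem_column]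
  unfold firstRow
  omega

/-- Rows outside `longRows` have no cell beyond column k, while a long row has a cell in each of the
columns 1, ..., k. -/
theorem card_add_mul_le_card_col (hanti : ∀ i j, 1 ≤ i → i ≤ j → j ≤ c → endRow c b j ≤ endRow c b i)
    (hend : ∀ i, 1 ≤ i → i ≤ c → c - 3 + 1 ≤ endRow c b i) {k : ℕ} (hk : 1 ≤ k) (hkc : k ≤ c) :
    ((univ : Finset (Cell.{u} c b)).filter fun x => x.row ∉ longRows c b k).card +
      k * (longRows c b k).card ≤
    ((univ : Finset (Cell.{u} c b)).filter fun x => x.col ≤ k).card := by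
  rw [← card_filter_add_card_filter_not (s := (univ : Finset (Cell.{u} c b)).filter
    fun x => x.col ≤ k) (fun x => x.row ∉ longRows c b k)]
  refine add_le_add (card_le_card ?_) ?_
  · intro x hx
    rw [mem_filter, mem_longRows hk hkc hend] at hx
    simp only [mem_filter, mem_univ, true_and, mem_longRows hk hkc hend]
    have hs := x.spec
    have hr := mem_column.1 x.row_mem_column
    have ha := hanti k x.col hk
    omega
  · calc k * (longRows c b k).card = (Icc 1 k ×ˢ longRows c b k).card := by simp
      _ ≤ _ := by
        refine card_le_card_of_forall_subsingleton
          (fun z x => z.1 = x.col ∧ z.2 = x.row) ?_ ?_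
        · rintro ⟨a, r⟩ h
          simp only [mem_product, mem_Icc] at h
          obtain ⟨⟨h1, h2⟩, h3⟩ := h
          obtain ⟨x, hx, hx'⟩ := exists_cell.{u} (c := c) (b := b) (r := r) (a := a) h1
            (h2.trans hkc) (by
              rw [mem_longRows hk hkc hend] at h3
              rw [mem_column]
              have := hanti a k h1 h2 hkc
              have := hend k hk hkc
              unfold firstRow
              omega)
          refine ⟨x, ?_, hx'.symm, hx.symm⟩
          simp only [mem_filter, mem_univ, true_and, not_not]
          exact ⟨by omega, hx ▸ h3⟩
        · rintro y - ⟨a, r⟩ ⟨-, h1, h2⟩ ⟨a', r'⟩ ⟨-, h1', h2'⟩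
          simp only at *
          rw [h1, h2, h1', h2']

set_option maxHeartbeats 2000000 in
-- For k ≤ s < c - 3, chain s is the ordinary part of row s, then spine cell s + 2, then the
-- exceptional cell of row s + 1; chain c - 3, if k ≤ c - 3, ends with spine cells c - 1 and c.
-- Chain 0 has the remaining spine cells and, if k ≤ c - 3, the exceptional cell of row k. Rows
-- beyond c - 3 are chains by themselves.
theorem below_of_chainLabel_eq {k : ℕ} (hk : 1 ≤ k) {x y : Cell.{u} c b} (hne : x ≠ y)
    (hx : 1 ≤ x.row → x.row ≤ c - 3 → k ≤ x.row) (hy : 1 ≤ y.row → y.row ≤ c - 3 → k ≤ y.row)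
    (h : chainLabel c k x.row x.col = chainLabel c k y.row y.col) :
    x.Below y ∨ y.Below x := by
  have hsx := x.spec
  have hsy := y.spec
  have h' : x.row = y.row → x.col ≠ y.col := fun h1 h2 => hne (Cell.ext_row_col h1 h2)
  simp only [Cell.Below, Cell.Left, Cell.Lower]
  unfold chainLabel at h
  unfold position height
  split_ifs at h ⊢ <;> omega

theorem alphaK_cellGraph_le
    (hanti : ∀ i j, 1 ≤ i → i ≤ j → j ≤ c → endRow c b j ≤ endRow c b i)
    (hend : ∀ i, 1 ≤ i → i ≤ c → c - 3 + 1 ≤ endRow c b i) {k : ℕ} (hk : 1 ≤ k) (hkc : k ≤ c) :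
    alphaK (cellGraph.{u} c b) k ≤
      ((univ : Finset (Cell.{u} c b)).filter fun x => x.col ≤ k).card := by
  have hcard := card_add_mul_le_card_col.{u} hanti hend hk hkc
  refine le_trans ?_ hcard
  refine alphaK_le_of_cover k _ (longRows c b k) (fun x => chainLabel c k x.row x.col) ?_ ?_
  · intro x hx
    simp only [mem_filter, mem_univ, true_and, not_not, mem_longRows hk hkc hend] at hx ⊢
    have := x.spec
    have := hend k hk hkc
    unfold chainLabel
    split_ifs <;> omega
  · intro x y hx hy h hne
    simp only [mem_filter, mem_univ, true_and, not_not, mem_longRows hk hkc hend] at hx hy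
    exact below_of_chainLabel_eq hk hne (by omega) (by omega) h

theorem rank_injOn {p : Finset (Cell.{u} c b)} (hp : (cellGraph c b).IsClique (p : Set _)) :
    Set.InjOn (fun x : Cell.{u} c b => rank c x.row x.col) p := by
  intro x hx y hy h
  by_contra hne
  rcases hp hx hy hne with h' | h'
  · exact (rank_lt_rank h').ne h
  · exact (rank_lt_rank h').ne h.symm

theorem cliqueNum_cellGraph : (cellGraph.{u} c b).cliqueNum = c := by
  apply le_antisymm
  · obtain ⟨p, hp⟩ := (cellGraph.{u} c b).exists_isNClique_cliqueNum
    rw [← hp.card_eq]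
    refine (card_le_card_of_injOn (t := Icc 1 c) _ (fun x _ => ?_)
      (rank_injOn hp.isClique)).trans (by simp)
    have := x.spec
    simp only [coe_Icc, Set.mem_Icc]
    unfold rank
    split_ifs <;> omega
  · have hcl : (cellGraph.{u} c b).IsClique
        (((univ : Finset (Cell.{u} c b)).filter fun x => x.row = 0 : Finset _) : Set _) := by
      intro x hx y hy hne
      simp only [coe_filter, mem_univ, true_and, Set.mem_ofPred_eq] at hx hy
      have h' : x.row = y.row → x.col ≠ y.col := fun h1 h2 => hne (Cell.ext_row_col h1 h2)
      rw [cellGraph_adj]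
      simp only [Cell.Below, Cell.Left, Cell.Lower, position, height, hx, hy]
      simp
      omega
    refine le_trans ?_ hcl.card_le_cliqueNum
    calc c = (Icc 1 c).card := by simp
      _ ≤ _ := by
        refine card_le_card_of_surjOn Cell.col ?_
        intro a ha
        rw [coe_Icc, Set.mem_Icc] at ha
        obtain ⟨x, hx, hx'⟩ := exists_cell.{u} (c := c) (b := b) (r := 0) ha.1 ha.2
          (mem_column.2 (Or.inl rfl))
        exact ⟨x, by simpa using hx, hx'⟩

/-- A neighbour off the spine is an ordinary cell of some row s < k, whose rank is its column, at
most s. -/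
theorem spine_or_short_of_below {k : ℕ} (hk : 1 ≤ k) (hkc : k ≤ c - 3) {x y : Cell.{u} c b}
    (hy : y.row = k) (hy' : y.col = k + 1) (h : x.Below y ∨ y.Below x) :
    rank c x.row x.col ≤ k + 2 ∧ (x.row = 0 ∧ x.col ≤ k + 1 ∨ x.row ≠ 0 ∧ rank c x.row x.col < k) := by
  have hsx := x.spec
  simp only [Cell.Below, Cell.Left, Cell.Lower] at h
  rw [hy, hy'] at h
  unfold position height at h
  unfold rank
  split_ifs at h ⊢ <;> omega

/-- No clique partition of the extremal graph is both `k`- and `l`-saturated if `k + 2 ≤ l < c`. -/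
theorem not_isSaturated_both
    (hanti : ∀ i j, 1 ≤ i → i ≤ j → j ≤ c → endRow c b j ≤ endRow c b i)
    (hend : ∀ i, 1 ≤ i → i ≤ c → c - 3 + 1 ≤ endRow c b i) {k l : ℕ} (hk : 1 ≤ k)
    (hkl : k + 2 ≤ l) (hl : l < c) {C : Finpartition (univ : Finset (Cell.{u} c b))}
    (hCk : IsSaturated (cellGraph c b) C k) (hCl : IsSaturated (cellGraph c b) C l) : False := by
  have hfam : ∀ {t n : ℕ}, t + 1 ≤ n → 1 ≤ n → n ≤ c → alphaK (cellGraph.{u} c b) n ≤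
      (univ.biUnion fun i : Fin n => levelSet.{u} c b t i).card := fun ht h1 hn =>
    (alphaK_cellGraph_le hanti hend h1 hn).trans (card_col_le_card_level ht hn)
  obtain ⟨y, hy, hy'⟩ := exists_cell.{u} (c := c) (b := b) (r := k) (a := k + 1) (by omega)
    (by omega) (mem_column.2 (by
      have := hend (k + 1) (by omega) (by omega)
      unfold firstRow
      omega))
  obtain ⟨p, hp, hyp⟩ := C.exists_mem (mem_univ y)
  have hcl := hCk.1 p hp
  have hrk : rank c y.row y.col = k + 2 := by
    rw [rank, if_pos (by omega), hy]
  -- With t = 0 the exceptional cell of row k has level k + 1, just outside the first k levels.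
  have hbig : k < p.card := by
    refine lt_card_of_notMem_biUnion hCk _ (fun i => isIndepSet_levelSet (t := 0) (by omega) i)
      (hfam (by omega) hk (by omega)) hp hyp ?_
    rw [mem_biUnion_levelSet, level, if_neg (by omega), if_pos (by omega)]
    omega
  have hbelow : ∀ x ∈ p, x ≠ y → rank c x.row x.col ≤ k + 2 ∧
      (x.row = 0 ∧ x.col ≤ k + 1 ∨ x.row ≠ 0 ∧ rank c x.row x.col < k) := fun x hx hne =>
    spine_or_short_of_below hk (by omega) hy hy' (hcl hx hyp hne)
  have hrank1 : ∀ x : Cell.{u} c b, 1 ≤ rank c x.row x.col := by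
    intro x
    have := x.spec
    unfold rank
    split_ifs <;> omega
  by_cases hspine : ∃ x ∈ p, x.row = 0
  · obtain ⟨x, hx, hx0⟩ := hspine
    have hxy : x ≠ y := by
      rintro rfl
      omega
    have hxc := hbelow x hx hxy
    have h1 := x.one_le_col
    -- The choice t = `x.col` - 1 gives x level c > l; the family is still optimal because `x.col` ≤
    -- k + 1 ≤ l.
    have hlarge : l < p.card := by
      refine lt_card_of_notMem_biUnion hCl _
        (fun i => isIndepSet_levelSet (t := x.col - 1) (by omega) i)
        (hfam (by omega) (by omega) (by omega)) hp hx ?_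
      rw [mem_biUnion_levelSet, level, if_pos hx0, if_neg (by omega), if_pos (by omega)]
      omega
    have hsmall : p.card ≤ k + 2 := by
      refine (card_le_card_of_injOn (t := Icc 1 (k + 2)) _ (fun z hz => ?_)
        (rank_injOn hcl)).trans (by simp)
      simp only [coe_Icc, Set.mem_Icc]
      refine ⟨hrank1 z, ?_⟩
      by_cases hzy : z = y
      · rw [hzy, hrk]
      · exact (hbelow z hz hzy).1
    omega
  · push Not at hspine
    -- Off the spine the other ranks lie in 1, ..., k - 1, so p has at most k elements,
    -- contradicting `hbig`.
    have hsmall : (p.erase y).card ≤ k - 1 := by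
      refine (card_le_card_of_injOn (t := Icc 1 (k - 1)) _ (fun z hz => ?_)
        ((rank_injOn hcl).mono (coe_subset.2 (erase_subset y p)))).trans (by simp)
      rw [mem_coe, mem_erase] at hz
      have := hbelow z hz.2 hz.1
      have := hspine z hz.2
      have := hrank1 z
      simp only [coe_Icc, Set.mem_Icc]
      omega
    rw [card_erase_of_mem hyp] at hsmall
    omega

end Extremal

/-! ### The characterization -/

/-- The difference sequence of a polyunsaturated graph is strictly decreasing between its second
and its next to last term. -/
theorem diffSeq_lt_of_isPolyunsaturated {V : Type u} [Fintype V] [DecidableEq V]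
    {G : SimpleGraph V} (hG : IsSGK G) (hG' : IsPolyunsaturated G) {i : ℕ} (hi : 2 ≤ i)
    (hic : i + 1 < G.cliqueNum) :
    diffSeq (alphaK G) (i + 1) < diffSeq (alphaK G) i := by
  obtain ⟨k, rfl⟩ : ∃ k, i = k + 1 := ⟨i - 1, by omega⟩
  obtain ⟨C, hC, hC'⟩ := hG univ k (by omega)
  let e : G.induce ((univ : Finset V) : Set V) ≃g G :=
    { toEquiv := Equiv.subtypeUnivEquiv fun x => mem_coe.2 (mem_univ x)
      map_rel_iff' := Iff.rfl }
  obtain ⟨D, hD⟩ := exists_saturated_of_iso e C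
  have h1 := hD _ hC
  have h2 := hD _ hC'
  simp only [diffSeq, if_neg (show k + 1 ≠ 1 by omega), if_neg (show k + 1 + 1 ≠ 1 by omega),
    Nat.add_sub_cancel]
  by_contra! hle
  -- Concavity pushes the norm at k + 2 down to at most α_{k+2}; weak duality gives the reverse
  -- inequality.
  have h3 := alphaK_le_kNorm h1.1 (k + 2)
  have h4 := kNorm_concave D k
  refine hG' k (k + 2) (by omega) (by omega) (by omega) hic (by omega) (by omega) (by omega)
    ⟨D, h1, h1.1, ?_⟩
  have := h1.2
  have := h2.2
  simp only [Nat.add_assoc, Nat.reduceAdd] at *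
  omega

/-- The extremal graph attains every admissible difference sequence. -/
theorem exists_polyunsaturated (c : ℕ) (hc : 1 ≤ c) (b : ℕ → ℕ)
    (hpos : ∀ i, 1 ≤ i → i ≤ c → 1 ≤ b i)
    (hmono : ∀ i, 1 ≤ i → i + 1 ≤ c → b (i + 1) ≤ b i)
    (hb : ∀ i, 2 ≤ i → i + 1 ≤ c - 1 → b (i + 1) < b i) :
    ∃ (V : Type u) (_ : Fintype V) (_ : DecidableEq V) (G : SimpleGraph V),
      IsSGK G ∧ IsPolyunsaturated G ∧ G.cliqueNum = c ∧
        (∀ i, 1 ≤ i → i ≤ c → diffSeq (alphaK G) i = (b i : ℤ)) ∧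
        IsComparabilityGraph G ∧ IsComparabilityGraph Gᶜ := by
  have hanti : ∀ i j, 1 ≤ i → i ≤ j → j ≤ c → endRow c b j ≤ endRow c b i :=
    fun i j => endRow_antitone hpos hmono hb
  have hend : ∀ i, 1 ≤ i → i ≤ c → c - 3 + 1 ≤ endRow c b i := fun i => le_endRow hpos hmono hb
  have halpha : ∀ k, 1 ≤ k → k ≤ c → alphaK (cellGraph.{u} c b) k = ∑ i ∈ Icc 1 k, b i := by
    intro k hk hkc
    rw [← card_col_le.{u} hkc hpos]
    refine le_antisymm (alphaK_cellGraph_le hanti hend hk hkc)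
      ((card_col_le_card_level (t := 0) hk hkc).trans (card_biUnion_le_alphaK _ fun i => ?_))
    exact isIndepSet_levelSet hc i
  refine ⟨Cell c b, inferInstance, inferInstance, cellGraph c b,
    isSGK_of_isComparabilityGraph isComparabilityGraph_cellGraph, ?_, cliqueNum_cellGraph, ?_,
    isComparabilityGraph_cellGraph, isComparabilityGraph_compl_cellGraph⟩
  · rintro k l hk hl hkc hlc h1 h2 h3 ⟨C, hCk, hCl⟩
    rw [cliqueNum_cellGraph] at hkc hlc
    rcases lt_or_ge k l with h | h
    · exact not_isSaturated_both hanti hend hk (by omega) hlc hCk hCl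
    · exact not_isSaturated_both hanti hend hl (by omega) hkc hCl hCk
  · intro i hi hic
    unfold diffSeq
    split_ifs with h
    · subst h
      simp [halpha 1 le_rfl hc]
    · obtain ⟨j, rfl⟩ : ∃ j, i = j + 1 := ⟨i - 1, by omega⟩
      rw [Nat.add_sub_cancel, halpha _ hi hic, halpha j (by omega) (by omega),
        sum_Icc_succ_top (by omega)]
      push_cast
      ring

end Polyunsaturated

theorem theoremT (c : ℕ) (hc : 1 ≤ c) (b : ℕ → ℕ)
    (hpos : ∀ i, 1 ≤ i → i ≤ c → 1 ≤ b i)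
    (hmono : ∀ i, 1 ≤ i → i + 1 ≤ c → b (i + 1) ≤ b i) :
    ((∃ (V : Type u) (_ : Fintype V) (_ : DecidableEq V) (G : SimpleGraph V),
        Polyunsaturated.IsSGK G ∧ Polyunsaturated.IsPolyunsaturated G ∧ G.cliqueNum = c ∧
        (∀ i, 1 ≤ i → i ≤ c →
          Polyunsaturated.diffSeq (Polyunsaturated.alphaK G) i = (b i : ℤ))) ↔
      (∀ i, 2 ≤ i → i + 1 ≤ c - 1 → b (i + 1) < b i)) ∧
    ((∃ (V : Type u) (_ : Fintype V) (_ : DecidableEq V) (G : SimpleGraph V),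
        Polyunsaturated.IsSGK G ∧ Polyunsaturated.IsPolyunsaturated G ∧ G.cliqueNum = c ∧
        (∀ i, 1 ≤ i → i ≤ c →
          Polyunsaturated.diffSeq (Polyunsaturated.alphaK G) i = (b i : ℤ)) ∧
        Polyunsaturated.IsComparabilityGraph G ∧ Polyunsaturated.IsComparabilityGraph Gᶜ) ↔
      (∀ i, 2 ≤ i → i + 1 ≤ c - 1 → b (i + 1) < b i)) := by
  have hnec : (∃ (V : Type u) (_ : Fintype V) (_ : DecidableEq V) (G : SimpleGraph V),
        Polyunsaturated.IsSGK G ∧ Polyunsaturated.IsPolyunsaturated G ∧ G.cliqueNum = c ∧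
        (∀ i, 1 ≤ i → i ≤ c →
          Polyunsaturated.diffSeq (Polyunsaturated.alphaK G) i = (b i : ℤ))) →
      ∀ i, 2 ≤ i → i + 1 ≤ c - 1 → b (i + 1) < b i := by
    rintro ⟨V, _, _, G, hG, hG', hcl, hdiff⟩ i hi hic
    have h := Polyunsaturated.diffSeq_lt_of_isPolyunsaturated hG hG' hi (by omega)
    rw [hdiff i (by omega) (by omega), hdiff (i + 1) (by omega) (by omega)] at h
    exact_mod_cast h
  have hsuff := Polyunsaturated.exists_polyunsaturated.{u} c hc b hpos hmono
  refine ⟨⟨hnec, fun hb => ?_⟩, ⟨?_, hsuff⟩⟩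
  · obtain ⟨V, _, _, G, h1, h2, h3, h4, -⟩ := hsuff hb
    exact ⟨V, _, _, G, h1, h2, h3, h4⟩
  · rintro ⟨V, _, _, G, h1, h2, h3, h4, -⟩
    exact hnec ⟨V, _, _, G, h1, h2, h3, h4⟩
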